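/- Let $X=(V,E)$ be a connected simple graph with bounded vertex degrees, with simplicial distance $d$. Assume that $X$ is Gromov hyperbolic, i.e. for some $\delta\ge 0$, in every geodesic triangle of $X$ each vertex of each side is at distance at most $\delta$ from the union of the other two sides; and assume that $X$ contains at least one bi-infinite geodesic. Let $\nu$ be a probability measure on $[0,\infty)$ with $\int t\,d\nu(t)<\infty$ and $\nu(\{0\})=0$, and let the edge weights $\omega=(\omega(e))_{e\in E}$ be i.i.d. with law $\nu$, i.e. $\omega$ is distributed according to the product probability on $[0,\infty)^E$. For a finite path $p=(e_1,\dots,e_m)$ put $|p|_\omega=\sum_i\omega(e_i)$, let $d_\omega(x,y)$ be the infimum of $|p|_\omega$ over all paths $p$ from $x$ to $y$, and call $p$ an $\omega$-geodesic from $x$ to $y$ if $|p|_\omega=d_\omega(x,y)$. Denote by $X_\omega$ the graph $X$ with the metric $d_\omega$; a bi-infinite geodesic of $X_\omega$ is a bi-infinite path in $X$ all of whose finite subpaths are $\omega$-geodesics. 1. For almost every $\omega$, $X_\omega$ has a bi-infinite geodesic. 2. Let $\gamma:\mathbb Z\to V$ be any bi-infinite quasi-geodesic of $X$, i.e. a bi-infinite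 path for which there are $C\ge1$, $K\ge0$ with $j-i\le C\,d(\gamma(i),\gamma(j))+K$ for all $i<j$. Then for almost every $\omega$ there is a finite set $A\subset V$ such that, for all sequences of pairs of vertices $x_n=\gamma(a_n)$, $y_n=\gamma(b_n)$ with $a_n\to-\infty$ and $b_n\to+\infty$, and for every $n$ with $a_n\le 0\le b_n$ (hence for all large $n$), $\omega$-geodesics from $x_n$ to $y_n$ exist and every one of them passes through a vertex of $A$. -/

import Mathlib

open MeasureTheory ProbabilityTheory Filter
open scoped NNReal ENNReal

noncomputable section

namespace FPP

variable {V : Type*} (G : SimpleGraph V)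

/-- The vertex degrees of `G` are bounded by a common natural number. -/
def BoundedDegree : Prop :=
  ∃ q : ℕ, ∀ v : V, (G.neighborSet v).encard ≤ q

/-! ### Geodesics, thin triangles and hyperbolicity (simplicial metric) -/

variable {G} in
/-- A finite path is geodesic if its number of edges is the distance between its endpoints. -/
def IsGeodesic {u v : V} (p : G.Walk u v) : Prop :=
  p.length = G.dist u v

variable {G} in
/-- Every vertex of `p` is at distance at most `δ` from `q` or from `r`. -/
def SideThin (δ : ℝ) {a b c d e f : V} (p : G.Walk a b) (q : G.Walk c d) (r : G.Walk e f) :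
    Prop :=
  ∀ v ∈ p.support, ∃ u : V, (u ∈ q.support ∨ u ∈ r.support) ∧ (G.dist v u : ℝ) ≤ δ

/-- `G` is Gromov hyperbolic: for some `δ`, all geodesic triangles are `δ`-thin. -/
def IsHyperbolic : Prop :=
  ∃ δ : ℝ, 0 ≤ δ ∧ ∀ (x₀ x₁ x₂ : V) (g₀ : G.Walk x₁ x₂) (g₁ : G.Walk x₂ x₀) (g₂ : G.Walk x₀ x₁),
    IsGeodesic g₀ → IsGeodesic g₁ → IsGeodesic g₂ →
      SideThin δ g₀ g₁ g₂ ∧ SideThin δ g₁ g₂ g₀ ∧ SideThin δ g₂ g₀ g₁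

/-! ### Bi-infinite paths -/

/-- A bi-infinite path: consecutive vertices are joined by an edge. -/
def IsBiPath (γ : ℤ → V) : Prop :=
  ∀ k : ℤ, G.Adj (γ k) (γ (k + 1))

/-- A bi-infinite geodesic for the simplicial metric. -/
def IsBiGeodesic (γ : ℤ → V) : Prop :=
  IsBiPath G γ ∧ ∀ i j : ℤ, i ≤ j → (G.dist (γ i) (γ j) : ℤ) = j - i

/-- A bi-infinite quasi-geodesic for the simplicial metric. -/
def IsBiQuasiGeodesic (γ : ℤ → V) : Prop :=
  IsBiPath G γ ∧ ∃ C K : ℝ, 1 ≤ C ∧ 0 ≤ K ∧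
    ∀ i j : ℤ, i < j → ((j - i : ℤ) : ℝ) ≤ C * (G.dist (γ i) (γ j) : ℝ) + K

/-! ### First passage percolation -/

variable {G}

/-- The `ω`-length of a finite path: the sum of the weights of its edges, with multiplicity. -/
def wLength (ω : G.edgeSet → ℝ≥0) : {u v : V} → G.Walk u v → ℝ≥0
  | _, _, .nil => 0
  | _, _, .cons h p => ω ⟨s(_, _), h⟩ + wLength ω p

/-- The weighted graph distance: the infimum of the `ω`-lengths of paths from `u` to `v`. -/
def wDist (ω : G.edgeSet → ℝ≥0) (u v : V) : ℝ≥0 :=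
  ⨅ p : G.Walk u v, wLength ω p

/-- A finite `ω`-geodesic. -/
def IsWGeodesic (ω : G.edgeSet → ℝ≥0) {u v : V} (p : G.Walk u v) : Prop :=
  wLength ω p = wDist ω u v

/-- A bi-infinite `ω`-geodesic: a bi-infinite path each of whose finite subpaths realizes the
`ω`-distance between its endpoints. -/
def IsBiWGeodesic (ω : G.edgeSet → ℝ≥0) (γ : ℤ → V) : Prop :=
  ∃ h : IsBiPath G γ, ∀ i j : ℤ, i ≤ j →
    ∑ k ∈ Finset.Ico i j, ω ⟨s(γ k, γ (k + 1)), h k⟩ = wDist ω (γ i) (γ j)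

variable (G)

/-- The law of i.i.d. edge weights with common distribution `ν`: the product measure on
`[0, ∞)^E`. -/
def weightLaw (ν : Measure ℝ≥0) : Measure (G.edgeSet → ℝ≥0) :=
  Measure.infinitePi (fun _ : G.edgeSet => ν)

end FPP

end

/-! An `ω`-geodesic between two ends of a quasi-geodesic γ cannot make a long detour away from γ,
because long detours in a hyperbolic graph are far longer than the piece of γ they bypass.

Geometry: γ stays close to the geodesics between its points (`IsQuasiGeodesic.exists_dist_le`), and
nearest-point projection to γ contracts walks far from γ: `2 ^ N` steps at distance of order δN move
the projection by a constant independent of `N`. Hence, for every factor L,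
`IsQuasiGeodesic.exists_crossing` finds in any walk from the left half of γ to the right half a
crossing between their R-neighbourhoods whose length is, up to an additive constant, at least L
times the stretch of γ it bypasses.

Probability: since ν has no atom at 0, an exponential Markov bound and a count of paths give a
linear lower bound for the weight of long simple paths (`exists_ae_le_mul_wLength`). Since ν has
finite mean, the strong law bounds the weight along γ linearly (`exists_ae_wDist_le`), and
Borel–Cantelli bounds the cost of reaching γ from its R-neighbourhood (`ae_exists_wDist_le`). The
slopes of these bounds do not depend on R, so L can be fixed before R. For L large, a long crossing
would cost more than following γ; so crossings are short and lie near `γ 0`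
(`ae_exists_forall_dist_le`).

For a bi-infinite geodesic γ, the `ω`-geodesics from `γ (-n)` to `γ n` thus all meet one finite
ball, and a limit along an ultrafilter is a bi-infinite `ω`-geodesic. -/

namespace FPP

/-! ### Thin triangles in terms of the distance function -/

section Geometry

variable {V : Type*} {G : SimpleGraph V}

/-- `v` lies on a geodesic from `x` to `y`. -/
def Between (G : SimpleGraph V) (x v y : V) : Prop :=
  G.dist x v + G.dist v y = G.dist x y

/-- Geodesic triangles are `δ`-thin, in terms of the relation `Between`. -/
def Thin (G : SimpleGraph V) (δ : ℕ) : Prop :=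
  ∀ x y z v : V, Between G x v y →
    ∃ u, (Between G x u z ∨ Between G y u z) ∧ G.dist v u ≤ δ

theorem Between.symm {x v y : V} (h : Between G x v y) : Between G y v x := by
  unfold Between at *
  rw [G.dist_comm (u := y) (v := v), G.dist_comm (u := v) (v := x), G.dist_comm (u := y) (v := x)]
  omega

theorem between_left (x y : V) : Between G x x y := by simp [Between]

theorem IsGeodesic.between (hconn : G.Connected) {x y v : V} {p : G.Walk x y} (hp : IsGeodesic p)
    (hv : v ∈ p.support) : Between G x v y := by
  classical
  have h1 := congrArg SimpleGraph.Walk.length (p.take_spec hv)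
  rw [SimpleGraph.Walk.length_append] at h1
  have h2 := G.dist_le (p.takeUntil v hv)
  have h3 := G.dist_le (p.dropUntil v hv)
  have h4 := hconn.dist_triangle (u := x) (v := v) (w := y)
  unfold IsGeodesic at hp
  unfold Between
  omega

theorem Between.exists_isGeodesic (hconn : G.Connected) {x y v : V} (h : Between G x v y) :
    ∃ p : G.Walk x y, IsGeodesic p ∧ v ∈ p.support := by
  obtain ⟨p, hp⟩ := hconn.exists_walk_length_eq_dist x v
  obtain ⟨q, hq⟩ := hconn.exists_walk_length_eq_dist v y
  refine ⟨p.append q, ?_, ?_⟩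
  · unfold IsGeodesic Between at *
    rw [SimpleGraph.Walk.length_append]
    omega
  · rw [SimpleGraph.Walk.mem_support_append_iff]
    exact Or.inl p.end_mem_support

theorem IsHyperbolic.exists_thin (hconn : G.Connected) (h : IsHyperbolic G) :
    ∃ δ : ℕ, Thin G δ := by
  obtain ⟨δ, -, h⟩ := h
  refine ⟨⌈δ⌉₊, fun x y z v hv => ?_⟩
  obtain ⟨g₀, hg₀, hv₀⟩ := hv.exists_isGeodesic hconn
  obtain ⟨g₁, hg₁, -⟩ := (between_left (G := G) y z).exists_isGeodesic hconn
  obtain ⟨g₂, hg₂, -⟩ := (between_left (G := G) z x).exists_isGeodesic hconn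
  obtain ⟨u, hu, hd⟩ := (h z x y g₀ g₁ g₂ hg₀ hg₁ hg₂).1 v hv₀
  refine ⟨u, ?_, by exact_mod_cast hd.trans (Nat.le_ceil δ)⟩
  rcases hu with hu | hu
  · exact Or.inr (hg₁.between hconn hu)
  · exact Or.inl (hg₂.between hconn hu).symm

theorem exists_between (hconn : G.Connected) (x y : V) {t : ℕ} (ht : t ≤ G.dist x y) :
    ∃ v, G.dist x v = t ∧ G.dist v y + t = G.dist x y := by
  obtain ⟨p, hp⟩ := hconn.exists_walk_length_eq_dist x y
  refine ⟨p.getVert t, ?_⟩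
  have h1 := G.dist_le (p.take t)
  have h2 := G.dist_le (p.drop t)
  have h3 := hconn.dist_triangle (u := x) (v := p.getVert t) (w := y)
  rw [SimpleGraph.Walk.take_length] at h1
  rw [SimpleGraph.Walk.drop_length] at h2
  omega

/-- A walk of length at most `2 ^ N` stays logarithmically close to any geodesic joining its
endpoints. -/
theorem Thin.exists_mem_support_dist_le (hconn : G.Connected) {δ : ℕ} (hδ : Thin G δ) (N : ℕ) :
    ∀ {x y v : V} (w : G.Walk x y), w.length ≤ 2 ^ N → Between G x v y →
      ∃ u ∈ w.support, G.dist v u ≤ δ * N := by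
  induction N with
  | zero =>
    intro x y v w hw hv
    have h1 := G.dist_le w
    unfold Between at hv
    by_cases hx : G.dist x v = 0
    · exact ⟨x, w.start_mem_support, by rw [G.dist_comm]; omega⟩
    · exact ⟨y, w.end_mem_support, by simp at hw; omega⟩
  | succ N ih =>
    intro x y v w hw hv
    obtain ⟨u, hu, hd⟩ := hδ x y (w.getVert (2 ^ N)) v hv
    have key : ∃ u' ∈ w.support, G.dist u u' ≤ δ * N := by
      rcases hu with hu | hu
      · obtain ⟨u', hu', hd'⟩ := ih (w.take (2 ^ N))
          (by rw [SimpleGraph.Walk.take_length]; omega) hu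
        exact ⟨u', (SimpleGraph.Walk.isSubwalk_take w _).support_subset hu', hd'⟩
      · obtain ⟨u', hu', hd'⟩ := ih (w.drop (2 ^ N))
          (by rw [SimpleGraph.Walk.drop_length]; rw [pow_succ] at hw; omega) hu.symm
        exact ⟨u', (SimpleGraph.Walk.isSubwalk_drop w _).support_subset hu', hd'⟩
    obtain ⟨u', hu', hd'⟩ := key
    refine ⟨u', hu', ?_⟩
    have := hconn.dist_triangle (u := v) (v := u) (w := u')
    rw [mul_add_one]
    omega

/-! ### Quasi-geodesics -/

/-- A bi-infinite quasi-geodesic with natural constants. -/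
def IsQuasiGeodesic (G : SimpleGraph V) (γ : ℤ → V) (C K : ℕ) : Prop :=
  IsBiPath G γ ∧ ∀ i j : ℤ, j - i ≤ C * (G.dist (γ i) (γ j) : ℤ) + K

theorem IsBiQuasiGeodesic.exists_isQuasiGeodesic {γ : ℤ → V} (h : IsBiQuasiGeodesic G γ) :
    ∃ C K : ℕ, IsQuasiGeodesic G γ C K := by
  obtain ⟨hγ, C, K, hC, hK, h⟩ := h
  refine ⟨⌈C⌉₊, ⌈K⌉₊, hγ, fun i j => ?_⟩
  rcases lt_or_ge i j with hij | hij
  · have h1 := h i j hij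
    have h2 : C * (G.dist (γ i) (γ j) : ℝ) ≤ ⌈C⌉₊ * (G.dist (γ i) (γ j) : ℝ) := by
      gcongr; exact Nat.le_ceil C
    have h3 := Nat.le_ceil K
    have h4 : ((j - i : ℤ) : ℝ) ≤
        ((⌈C⌉₊ * (G.dist (γ i) (γ j) : ℤ) + ⌈K⌉₊ : ℤ) : ℝ) := by
      push_cast at h1 ⊢; linarith
    exact_mod_cast h4
  · have : (0 : ℤ) ≤ ⌈C⌉₊ * (G.dist (γ i) (γ j) : ℤ) + ⌈K⌉₊ := by positivity
    omega

theorem IsQuasiGeodesic.abs_sub_le {γ : ℤ → V} {C K : ℕ} (h : IsQuasiGeodesic G γ C K)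
    {i j : ℤ} {d : ℕ} (hd : G.dist (γ i) (γ j) ≤ d) : |j - i| ≤ C * (d : ℤ) + K := by
  have h1 := h.2 i j
  have h2 := h.2 j i
  rw [G.dist_comm] at h2
  have h3 : C * (G.dist (γ i) (γ j) : ℤ) ≤ C * (d : ℤ) := by gcongr
  rw [abs_le]
  constructor <;> linarith

theorem IsBiPath.exists_walk {γ : ℤ → V} (h : IsBiPath G γ) (i : ℤ) (n : ℕ) :
    ∃ p : G.Walk (γ i) (γ (i + n)), p.length = n ∧ ∀ u ∈ p.support, ∃ k, u = γ k := by
  induction n with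
  | zero =>
    refine ⟨SimpleGraph.Walk.nil.copy rfl (by simp), by simp, ?_⟩
    simp only [SimpleGraph.Walk.support_copy, SimpleGraph.Walk.support_nil, List.mem_singleton]
    rintro u rfl
    exact ⟨i, rfl⟩
  | succ n ih =>
    obtain ⟨p, hp, hs⟩ := ih
    have hadj : G.Adj (γ (i + n)) (γ (i + (n + 1 : ℕ))) := by
      have := h (i + n)
      push_cast
      rwa [← add_assoc]
    refine ⟨p.concat hadj, by simp [hp], ?_⟩
    simp only [SimpleGraph.Walk.support_concat, List.mem_append, List.mem_singleton]
    rintro u (hu | rfl)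
    · exact hs u hu
    · exact ⟨_, rfl⟩

theorem IsBiPath.exists_walk_natAbs {γ : ℤ → V} (h : IsBiPath G γ) (i j : ℤ) :
    ∃ p : G.Walk (γ i) (γ j), p.length = (j - i).natAbs ∧ ∀ u ∈ p.support, ∃ k, u = γ k := by
  rcases le_total i j with hij | hij
  · obtain ⟨p, hp, hs⟩ := h.exists_walk i (j - i).natAbs
    have : i + ((j - i).natAbs : ℤ) = j := by omega
    exact ⟨p.copy rfl (by rw [this]), by simpa using hp, by simpa using hs⟩
  · obtain ⟨p, hp, hs⟩ := h.exists_walk j (j - i).natAbs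
    have : j + ((j - i).natAbs : ℤ) = i := by omega
    exact ⟨(p.copy rfl (by rw [this])).reverse, by simpa using hp, by simpa using hs⟩

/-- Exponential beats linear, with N about D/(δ+1). It says that a walk of length linear in a large
`D` is too short to avoid a ball of radius `D` centred on a geodesic joining its endpoints. -/
theorem exists_affine_le_two_pow (δ a b : ℕ) :
    ∃ H : ℕ, ∀ D, H ≤ D → ∃ N, δ * N < D ∧ a * D + b ≤ 2 ^ N := by
  have hlim : Tendsto (fun n : ℕ => (n : ℝ) ^ 1 / 2 ^ n) atTop (nhds 0) :=
    tendsto_pow_const_div_const_pow_of_one_lt 1 (by norm_num)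
  set c : ℕ := a * (δ + 1) * 2 + b + 1 with hc
  have hcpos : (0 : ℝ) < 1 / c := by positivity
  obtain ⟨M, hM⟩ := eventually_atTop.1 (hlim.eventually (gt_mem_nhds hcpos))
  refine ⟨(M + 1) * (δ + 1), fun D hD => ⟨D / (δ + 1), ?_, ?_⟩⟩
  · have h1 : (δ + 1) * (D / (δ + 1)) ≤ D := Nat.mul_div_le D (δ + 1)
    have h2 : M + 1 ≤ D / (δ + 1) := (Nat.le_div_iff_mul_le (by omega)).2 hD
    nlinarith
  · set n := D / (δ + 1) with hn
    have h2 : M + 1 ≤ n := (Nat.le_div_iff_mul_le (by omega)).2 hD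
    have h3 : D < (δ + 1) * (n + 1) := Nat.lt_mul_div_succ D (by omega)
    have h4 := hM n (by omega)
    rw [pow_one, div_lt_div_iff₀ (by positivity) (by positivity)] at h4
    have h5 : n * c < 2 ^ n := by
      have : (n : ℝ) * c < 2 ^ n := by linarith
      exact_mod_cast this
    have h6 : D ≤ (δ + 1) * (2 * n) := by nlinarith
    have h7 : a * D ≤ a * ((δ + 1) * (2 * n)) := by gcongr
    have h8 : n * c = a * ((δ + 1) * (2 * n)) + n * b + n := by rw [hc]; ring
    nlinarith

/-- Geodesics between points of a quasi-geodesic stay uniformly close to it. -/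
theorem IsQuasiGeodesic.exists_dist_le (hconn : G.Connected) {δ : ℕ} (hδ : Thin G δ)
    {γ : ℤ → V} {C K : ℕ} (hγ : IsQuasiGeodesic G γ C K) :
    ∃ H : ℕ, ∀ i j v, Between G (γ i) v (γ j) → ∃ k, G.dist v (γ k) ≤ H := by
  classical
  -- The detour built below consists of two walks of length at most D and a piece of γ between
  -- points at distance at most 6D.
  obtain ⟨H, hH⟩ := exists_affine_le_two_pow δ (6 * C + 2) K
  refine ⟨H, fun i j => ?_⟩
  have hex : ∃ D, ∀ v, Between G (γ i) v (γ j) → ∃ k, G.dist v (γ k) ≤ D :=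
    ⟨G.dist (γ i) (γ j), fun v hv => ⟨j, by unfold Between at hv; omega⟩⟩
  -- The largest distance to γ from a point of a geodesic from `γ i` to `γ j`; minimality of `D`
  -- yields a point v attaining it.
  set D := Nat.find hex with hD
  have hDs : ∀ v, Between G (γ i) v (γ j) → ∃ k, G.dist v (γ k) ≤ D := Nat.find_spec hex
  suffices D ≤ H by
    intro v hv
    obtain ⟨k, hk⟩ := hDs v hv
    exact ⟨k, hk.trans this⟩
  by_contra hlt
  push Not at hlt
  have hmin := Nat.find_min hex (show D - 1 < D by omega)
  push Not at hmin
  obtain ⟨v, hv, hvD⟩ := hmin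
  have hvD' : ∀ k, D ≤ G.dist v (γ k) := fun k => by have := hvD k; omega
  obtain ⟨N, hN, hN2⟩ := hH D hlt.le
  -- Move 2D from v towards `γ i'`, then at most D to γ: the second walk stays at distance at least
  -- D from v. If `γ i'` is within 2D already, stop there.
  have side : ∀ i', (∀ y, Between G (γ i') y v → ∃ k, G.dist y (γ k) ≤ D) →
      ∃ y k, Between G (γ i') y v ∧ G.dist v y ≤ 2 * D ∧ G.dist y (γ k) ≤ D ∧
        ∃ p : G.Walk y (γ k), p.length ≤ D ∧ ∀ u ∈ p.support, D ≤ G.dist v u := by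
    intro i' hi'
    by_cases hlong : G.dist v (γ i') ≤ 2 * D
    · refine ⟨γ i', i', between_left _ _, hlong, by simp, SimpleGraph.Walk.nil, by simp, ?_⟩
      simpa using hvD' i'
    · obtain ⟨y, hy1, hy2⟩ := exists_between hconn v (γ i') (t := 2 * D) (by omega)
      have hb : Between G (γ i') y v := by
        apply Between.symm
        unfold Between
        omega
      obtain ⟨k, hk⟩ := hi' y hb
      obtain ⟨p, hp⟩ := hconn.exists_walk_length_eq_dist y (γ k)
      refine ⟨y, k, hb, hy1.le, hk, p, by omega, fun u hu => ?_⟩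
      have h1 := (show IsGeodesic p from hp).between hconn hu
      have h2 := hconn.dist_triangle (u := v) (v := u) (w := y)
      rw [G.dist_comm (u := u) (v := y)] at h2
      unfold Between at h1
      omega
  have hbi : ∀ y, Between G (γ i) y v → Between G (γ i) y (γ j) := by
    intro y hy
    have h1 := hconn.dist_triangle (u := y) (v := v) (w := γ j)
    have h2 := hconn.dist_triangle (u := γ i) (v := y) (w := γ j)
    unfold Between at *
    omega
  have hbj : ∀ z, Between G (γ j) z v → Between G (γ i) z (γ j) := by
    intro z hz
    have hv' := hv.symm
    apply Between.symm
    have h1 := hconn.dist_triangle (u := z) (v := v) (w := γ i)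
    have h2 := hconn.dist_triangle (u := γ j) (v := z) (w := γ i)
    unfold Between at *
    omega
  obtain ⟨y, k, hy, hyd, hyk, p, hp, hps⟩ := side i fun y hy => hDs y (hbi y hy)
  obtain ⟨z, l, hz, hzd, hzl, q, hq, hqs⟩ := side j fun z hz => hDs z (hbj z hz)
  have hkl : G.dist (γ k) (γ l) ≤ 6 * D := by
    have h1 := hconn.dist_triangle (u := γ k) (v := y) (w := γ l)
    have h2 := hconn.dist_triangle (u := y) (v := v) (w := γ l)
    have h3 := hconn.dist_triangle (u := v) (v := z) (w := γ l)
    rw [G.dist_comm (u := γ k) (v := y)] at h1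
    rw [G.dist_comm (u := y) (v := v)] at h2
    omega
  have habs := hγ.abs_sub_le hkl
  obtain ⟨r, hr, hrs⟩ := hγ.1.exists_walk_natAbs k l
  have hvyz : Between G y v z := by
    have h1 := hconn.dist_triangle (u := γ i) (v := y) (w := z)
    have h2 := hconn.dist_triangle (u := γ i) (v := z) (w := γ j)
    have h3 := hconn.dist_triangle (u := y) (v := v) (w := z)
    have hz' := hz.symm
    unfold Between at *
    omega
  have hlen : (p.append (r.append q.reverse)).length ≤ 2 ^ N := by
    simp only [SimpleGraph.Walk.length_append, SimpleGraph.Walk.length_reverse, hr]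
    have : ((l - k).natAbs : ℤ) ≤ C * (6 * D : ℕ) + K := by rwa [Int.natCast_natAbs]
    have h' : (l - k).natAbs ≤ C * (6 * D) + K := by exact_mod_cast this
    have h'' : (6 * C + 2) * D + K = C * (6 * D) + K + D + D := by ring
    omega
  obtain ⟨u, hu, hdu⟩ := hδ.exists_mem_support_dist_le hconn N _ hlen hvyz
  have : D ≤ G.dist v u := by
    simp only [SimpleGraph.Walk.mem_support_append_iff, SimpleGraph.Walk.support_reverse,
      List.mem_reverse] at hu
    rcases hu with hu | hu | hu
    · exact hps u hu
    · obtain ⟨m, rfl⟩ := hrs u hu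
      exact hvD' m
    · exact hqs u hu
  omega

/-! ### Nearest-point projection to a quasi-geodesic -/

/-- `γ k` is a point of `γ` nearest to `x`. -/
def IsNearest (G : SimpleGraph V) (γ : ℤ → V) (x : V) (k : ℤ) : Prop :=
  ∀ l, G.dist x (γ k) ≤ G.dist x (γ l)

theorem exists_isNearest (G : SimpleGraph V) (γ : ℤ → V) (x : V) : ∃ k, IsNearest G γ x k := by
  obtain ⟨k, -, hk⟩ := exists_minimalFor_of_wellFoundedLT (fun _ : ℤ => True)
    (fun k => G.dist x (γ k)) ⟨0, trivial⟩
  exact ⟨k, fun l => by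
    by_contra h
    exact h (hk trivial (by simpa using (not_le.1 h).le))⟩

/-- Nearest-point projection to `γ` contracts short walks that stay far from `γ`. -/
theorem Thin.dist_isNearest_le (hconn : G.Connected) {δ : ℕ} (hδ : Thin G δ) {γ : ℤ → V} {H : ℕ}
    (hH : ∀ i j v, Between G (γ i) v (γ j) → ∃ k, G.dist v (γ k) ≤ H) {N R : ℕ}
    (hR : δ * N + 2 * δ + H < R) {x y : V} (w : G.Walk x y) (hw : w.length ≤ 2 ^ N)
    (hfar : ∀ u ∈ w.support, ∀ k, R ≤ G.dist u (γ k)) {k l : ℤ}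
    (hk : IsNearest G γ x k) (hl : IsNearest G γ y l) :
    G.dist (γ k) (γ l) ≤ 2 * H + 8 * δ + 1 := by
  by_contra hlt
  push Not at hlt
  -- In the quadrilateral `γ k`, `γ l`, y, x the point m is within 2δ of another side. It is too far
  -- from both projection points to be near the sides ending there, and too close to γ to be near
  -- the side from x to y, which follows the far walk `w`.
  obtain ⟨m, hm1, hm2⟩ := exists_between hconn (γ k) (γ l) (t := H + 4 * δ + 1) (by omega)
  obtain ⟨k', hk'⟩ := hH k l m (by unfold Between; omega)
  -- As u lies on a geodesic from z to its projection, `γ i` is also a nearest point of γ to u, so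
  -- it is no farther from u than `γ k'`.
  have near : ∀ {z u : V} {i : ℤ}, IsNearest G γ z i → Between G (γ i) u z →
      G.dist (γ i) m ≤ H + 2 * G.dist m u := by
    intro z u i hi hu
    have h1 := hi k'
    have h2 := hconn.dist_triangle (u := z) (v := u) (w := γ k')
    have h3 := hconn.dist_triangle (u := u) (v := m) (w := γ k')
    have h4 := hconn.dist_triangle (u := γ i) (v := u) (w := m)
    unfold Between at hu
    rw [G.dist_comm (u := z) (v := γ i)] at h1
    rw [G.dist_comm (u := z) (v := u)] at h2
    rw [G.dist_comm (u := u) (v := m)] at h3 h4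
    omega
  obtain ⟨u, hu | hu, hd⟩ := hδ (γ k) (γ l) x m (by unfold Between; omega)
  · have := near hk hu
    omega
  · obtain ⟨u', hu' | hu', hd'⟩ := hδ (γ l) x y u hu
    · have h1 := near hl hu'
      have h2 := hconn.dist_triangle (u := m) (v := u) (w := u')
      rw [G.dist_comm (u := γ l)] at h1
      omega
    · obtain ⟨u'', hu'', hd''⟩ := hδ.exists_mem_support_dist_le hconn N w hw hu'
      have h0 := hfar u'' hu'' k'
      have h1 := hconn.dist_triangle (u := m) (v := u) (w := u')
      have h2 := hconn.dist_triangle (u := m) (v := u') (w := u'')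
      have h3 := hconn.dist_triangle (u := u'') (v := m) (w := γ k')
      rw [G.dist_comm (u := u'') (v := m)] at h3
      omega

/-- Cut the walk into n + 1 pieces of length at most `2 ^ N` and add up the projection shifts. The
shift per piece does not involve `N`; only the required distance `R` does. -/
theorem Thin.abs_sub_isNearest_le (hconn : G.Connected) {δ : ℕ} (hδ : Thin G δ) {γ : ℤ → V}
    {C K H : ℕ} (hγ : IsQuasiGeodesic G γ C K)
    (hH : ∀ i j v, Between G (γ i) v (γ j) → ∃ k, G.dist v (γ k) ≤ H) {N R : ℕ}
    (hR : δ * N + 2 * δ + H < R) (n : ℕ) :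
    ∀ {x y : V} (w : G.Walk x y), w.length ≤ (n + 1) * 2 ^ N →
    (∀ u ∈ w.support, ∀ k, R ≤ G.dist u (γ k)) → ∀ {k l : ℤ},
    IsNearest G γ x k → IsNearest G γ y l →
    |l - k| ≤ (C * (2 * H + 8 * δ + 1 : ℕ) + K) * ((n : ℤ) + 1) := by
  induction n with
  | zero =>
    intro x y w hw hfar k l hk hl
    have := hγ.abs_sub_le
      (hδ.dist_isNearest_le hconn hH hR w (by simpa using hw) hfar hk hl)
    simpa using this
  | succ n ih =>
    intro x y w hw hfar k l hk hl
    obtain ⟨m, hm⟩ := exists_isNearest G γ (w.getVert (2 ^ N))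
    have h1 := hγ.abs_sub_le
      (hδ.dist_isNearest_le hconn hH hR (w.take (2 ^ N))
        (by rw [SimpleGraph.Walk.take_length]; omega)
        (fun u hu => hfar u ((SimpleGraph.Walk.isSubwalk_take w _).support_subset hu)) hk hm)
    have h2 := ih (w.drop (2 ^ N))
      (by rw [SimpleGraph.Walk.drop_length]; rw [add_mul _ 1, one_mul] at hw; omega)
      (fun u hu => hfar u ((SimpleGraph.Walk.isSubwalk_drop w _).support_subset hu)) hm hl
    have h3 := abs_sub_le l m k
    push_cast at h1 h2 ⊢
    linarith

theorem exists_append_append {x y : V} (p : G.Walk x y) {s t : ℕ} (hst : s ≤ t)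
    (ht : t ≤ p.length) :
    ∃ (p₁ : G.Walk x (p.getVert s)) (p₂ : G.Walk (p.getVert s) (p.getVert t))
      (p₃ : G.Walk (p.getVert t) y), p = p₁.append (p₂.append p₃) ∧ p₂.length = t - s ∧
        ∀ i ≤ t - s, p₂.getVert i = p.getVert (s + i) := by
  have he : (p.drop s).getVert (t - s) = p.getVert t := by
    rw [SimpleGraph.Walk.drop_getVert]; congr 1; omega
  refine ⟨p.take s, ((p.drop s).take (t - s)).copy rfl he,
    ((p.drop s).drop (t - s)).copy he rfl, ?_, ?_, ?_⟩
  · have h1 := SimpleGraph.Walk.append_take_drop_eq (p.drop s) (t - s)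
    have h2 : (((p.drop s).take (t - s)).copy rfl he).append
        (((p.drop s).drop (t - s)).copy he rfl) = p.drop s := by
      rw [SimpleGraph.Walk.append_copy_copy, h1, SimpleGraph.Walk.copy_rfl_rfl]
    rw [h2, SimpleGraph.Walk.append_take_drop_eq]
  · rw [SimpleGraph.Walk.length_copy, SimpleGraph.Walk.take_length, SimpleGraph.Walk.drop_length]
    omega
  · intro i hi
    rw [SimpleGraph.Walk.getVert_copy, SimpleGraph.Walk.take_getVert,
      SimpleGraph.Walk.drop_getVert]
    congr 1
    omega

/-- Any walk joining the two ends of a quasi-geodesic has a subwalk that joins the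
`R`-neighbourhoods of its two halves and that is either short, or longer by a factor `L` than the
corresponding portion of the quasi-geodesic. -/
theorem IsQuasiGeodesic.exists_crossing (hconn : G.Connected) {δ : ℕ} (hδ : Thin G δ)
    {γ : ℤ → V} {C K : ℕ} (hγ : IsQuasiGeodesic G γ C K) (L : ℕ) :
    ∃ R Q : ℕ, ∀ a b : ℤ, a ≤ 0 → 0 ≤ b → ∀ p : G.Walk (γ a) (γ b),
      ∃ (s t : ℕ) (k l : ℤ), s ≤ t ∧ t ≤ p.length ∧ k ≤ 0 ∧ 0 ≤ l ∧
        G.dist (p.getVert s) (γ k) ≤ R ∧ G.dist (p.getVert t) (γ l) ≤ R ∧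
        L * (l - k) ≤ ((t - s : ℕ) : ℤ) + Q := by
  classical
  obtain ⟨H, hH⟩ := hγ.exists_dist_le hconn hδ
  set D := C * (2 * H + 8 * δ + 1) + K with hD
  -- `D` bounds the index shift per `2 ^ N` steps and is independent of `N`, so `N` may be taken
  -- large enough to make each unit of index cost `L` steps.
  set N := L * D with hN
  have hND : L * D ≤ 2 ^ N := (Nat.lt_two_pow_self).le
  set R := δ * N + 2 * δ + H + 1 with hR
  set J := C * (2 * R + 2) + K with hJ
  refine ⟨R, L * D + L * (2 * J), fun a b ha hb p => ?_⟩
  -- s is the last time near the left half of γ and t the first time from s on near the right half;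
  -- strictly between them the walk is far from all of γ.
  let PL : ℕ → Prop := fun s => ∃ k ≤ 0, G.dist (p.getVert s) (γ k) ≤ R
  have hPL0 : PL 0 := ⟨a, ha, by simp⟩
  set s := Nat.findGreatest PL p.length with hs
  have hsl : s ≤ p.length := Nat.findGreatest_le _
  have hPLs : PL s := Nat.findGreatest_spec (Nat.zero_le _) hPL0
  have hsmax : ∀ r, s < r → r ≤ p.length → ¬ PL r := fun r h1 h2 =>
    Nat.findGreatest_is_greatest h1 h2
  have hex : ∃ t, s ≤ t ∧ ∃ l ≥ 0, G.dist (p.getVert t) (γ l) ≤ R :=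
    ⟨p.length, hsl, b, hb, by simp⟩
  set t := Nat.find hex with ht
  obtain ⟨hst, l, hl, hdl⟩ := Nat.find_spec hex
  rw [← ht] at hst hdl
  have htmin : ∀ r, r < t → s ≤ r → ∀ l ≥ 0, R < G.dist (p.getVert r) (γ l) := by
    intro r hr hsr l hl
    by_contra h
    exact Nat.find_min hex hr ⟨hsr, l, hl, not_lt.1 h⟩
  have htl : t ≤ p.length := Nat.find_min' hex ⟨hsl, b, hb, by simp⟩
  obtain ⟨k, hk, hdk⟩ := hPLs
  refine ⟨s, t, k, l, hst, htl, hk, hl, hdk, hdl, ?_⟩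
  have hLnn : (0 : ℤ) ≤ L := by positivity
  have step : ∀ r, r < p.length → G.dist (p.getVert r) (p.getVert (r + 1)) ≤ 1 := fun r hr =>
    (SimpleGraph.dist_eq_one_iff_adj.2 (p.adj_getVert_succ hr)).le
  rcases Nat.lt_or_ge t (s + 2) with hlt | hge
  · have h1 : G.dist (γ k) (γ l) ≤ 2 * R + 2 := by
      have h2 := hconn.dist_triangle (u := γ k) (v := p.getVert s) (w := γ l)
      have h3 := hconn.dist_triangle (u := p.getVert s) (v := p.getVert t) (w := γ l)
      have h4 : G.dist (p.getVert s) (p.getVert t) ≤ 1 := by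
        rcases (show t = s ∨ t = s + 1 by omega) with h | h
        · rw [h]; simp
        · rw [h]; exact step s (by omega)
      rw [G.dist_comm (u := γ k) (v := p.getVert s)] at h2
      omega
    have h2 := (le_abs_self _).trans (hγ.abs_sub_le h1)
    have h3 : l - k ≤ J := by rw [hJ]; push_cast at h2 ⊢; linarith
    have h4 : (L : ℤ) * (l - k) ≤ L * J := by gcongr
    have h5 : (0 : ℤ) ≤ L * D := by positivity
    have h6 : (0 : ℤ) ≤ L * J := by positivity
    push_cast
    linarith
  · have hfar : ∀ r, s < r → r < t → ∀ m, R < G.dist (p.getVert r) (γ m) := by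
      intro r h1 h2 m
      rcases le_total 0 m with hm | hm
      · exact htmin r h2 h1.le m hm
      · by_contra h
        exact hsmax r h1 (by omega) ⟨m, hm, not_lt.1 h⟩
    -- The projection estimate needs every vertex far from γ, so it is applied from s + 1 to t - 1;
    -- each trimmed end shifts the index by at most `J`.
    obtain ⟨k₁, hk₁⟩ := exists_isNearest G γ (p.getVert (s + 1))
    obtain ⟨l₁, hl₁⟩ := exists_isNearest G γ (p.getVert (t - 1))
    have hkk : |k₁ - k| ≤ J := by
      have h1 : G.dist (p.getVert (s + 1)) (γ k) ≤ R + 1 := by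
        have h2 := hconn.dist_triangle (u := p.getVert (s + 1)) (v := p.getVert s) (w := γ k)
        have h3 := step s (by omega)
        rw [G.dist_comm] at h3
        omega
      have h2 := hk₁ k
      have h3 := hconn.dist_triangle (u := γ k) (v := p.getVert (s + 1)) (w := γ k₁)
      rw [G.dist_comm (u := γ k) (v := p.getVert (s + 1))] at h3
      have := hγ.abs_sub_le (show G.dist (γ k) (γ k₁) ≤ 2 * R + 2 by omega)
      exact_mod_cast this
    have hll : |l - l₁| ≤ J := by
      have h1 : G.dist (p.getVert (t - 1)) (γ l) ≤ R + 1 := by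
        have h2 := hconn.dist_triangle (u := p.getVert (t - 1)) (v := p.getVert t) (w := γ l)
        have h3 := step (t - 1) (by omega)
        rw [show t - 1 + 1 = t by omega] at h3
        omega
      have h2 := hl₁ l
      have h3 := hconn.dist_triangle (u := γ l₁) (v := p.getVert (t - 1)) (w := γ l)
      rw [G.dist_comm (u := γ l₁) (v := p.getVert (t - 1))] at h3
      have := hγ.abs_sub_le (show G.dist (γ l₁) (γ l) ≤ 2 * R + 2 by omega)
      exact_mod_cast this
    obtain ⟨-, q, -, -, hq, hqv⟩ := exists_append_append p (s := s + 1) (t := t - 1)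
      (by omega) (by omega)
    have hqfar : ∀ u ∈ q.support, ∀ m, R ≤ G.dist u (γ m) := by
      intro u hu m
      obtain ⟨i, rfl, hi⟩ := SimpleGraph.Walk.mem_support_iff_exists_getVert.1 hu
      rw [hqv i (by omega)]
      exact (hfar _ (by omega) (by omega) m).le
    set n := q.length / 2 ^ N with hn
    have hmain := hδ.abs_sub_isNearest_le hconn hγ hH (N := N) (R := R) (by omega) n q
      (by rw [mul_comm]; exact (Nat.lt_mul_div_succ _ (by positivity)).le) hqfar hk₁ hl₁
    have hmain' : |l₁ - k₁| ≤ (D : ℤ) * (n + 1) := by rw [hD]; push_cast at hmain ⊢; exact hmain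
    have h1 : L * D * n ≤ t - s := by
      calc L * D * n ≤ 2 ^ N * n := by gcongr
        _ ≤ q.length := Nat.mul_div_le _ _
        _ ≤ t - s := by omega
    have h1' : (L : ℤ) * D * n ≤ ((t - s : ℕ) : ℤ) := by exact_mod_cast h1
    have h2 : l - k ≤ D * (n + 1) + 2 * J := by
      have := le_abs_self (l₁ - k₁)
      have := le_abs_self (l - l₁)
      have := le_abs_self (k₁ - k)
      linarith
    have h3 : (L : ℤ) * (l - k) ≤ L * (D * (n + 1) + 2 * J) := by gcongr
    push_cast
    linarith

end Geometry

/-! ### Weighted lengths of walks -/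

section Weights

variable {V : Type*} {G : SimpleGraph V}

theorem wLength_append (ω : G.edgeSet → ℝ≥0) {u v w : V} (p : G.Walk u v) (q : G.Walk v w) :
    wLength ω (p.append q) = wLength ω p + wLength ω q := by
  induction p with
  | nil => simp [wLength]
  | cons h p ih => simp [wLength, ih, add_assoc]

theorem wLength_reverse (ω : G.edgeSet → ℝ≥0) {u v : V} (p : G.Walk u v) :
    wLength ω p.reverse = wLength ω p := by
  induction p with
  | nil => simp [wLength]
  | cons h p ih =>
    simp only [SimpleGraph.Walk.reverse_cons, wLength_append, wLength, ih, add_zero]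
    rw [add_comm]
    congr 2
    exact Subtype.ext Sym2.eq_swap

theorem wLength_bypass_le [DecidableEq V] (ω : G.edgeSet → ℝ≥0) {u v : V} (p : G.Walk u v) :
    wLength ω p.bypass ≤ wLength ω p := by
  induction p with
  | nil => simp [wLength, SimpleGraph.Walk.bypass]
  | @cons u v w h p ih =>
    simp only [SimpleGraph.Walk.bypass]
    split_ifs with hs
    · have h1 := congrArg (wLength ω) (p.bypass.take_spec hs)
      rw [wLength_append] at h1
      simp only [wLength]
      calc wLength ω (p.bypass.dropUntil u hs) ≤ wLength ω p.bypass := by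
            rw [← h1]; exact le_add_self
        _ ≤ wLength ω p := ih
        _ ≤ _ := le_add_self
    · simp only [wLength]
      gcongr

theorem wDist_le (ω : G.edgeSet → ℝ≥0) {u v : V} (p : G.Walk u v) : wDist ω u v ≤ wLength ω p :=
  ciInf_le' _ p

theorem le_wDist (hconn : G.Connected) {ω : G.edgeSet → ℝ≥0} {u v : V} {c : ℝ≥0}
    (h : ∀ p : G.Walk u v, c ≤ wLength ω p) : c ≤ wDist ω u v :=
  have : Nonempty (G.Walk u v) := hconn.preconnected u v
  le_ciInf h

theorem wDist_triangle (hconn : G.Connected) (ω : G.edgeSet → ℝ≥0) (u v w : V) :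
    wDist ω u w ≤ wDist ω u v + wDist ω v w := by
  have : Nonempty (G.Walk u v) := hconn.preconnected u v
  have : Nonempty (G.Walk v w) := hconn.preconnected v w
  refine NNReal.le_iInf_add_iInf fun p q => ?_
  rw [← wLength_append]
  exact wDist_le ω _

theorem wDist_comm (hconn : G.Connected) (ω : G.edgeSet → ℝ≥0) (u v : V) :
    wDist ω u v = wDist ω v u :=
  le_antisymm
    (le_wDist hconn fun p => (wDist_le ω p.reverse).trans (wLength_reverse ω p).le)
    (le_wDist hconn fun p => (wDist_le ω p.reverse).trans (wLength_reverse ω p).le)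

theorem IsWGeodesic.bypass [DecidableEq V] {ω : G.edgeSet → ℝ≥0} {u v : V} {p : G.Walk u v}
    (hp : IsWGeodesic ω p) : IsWGeodesic ω p.bypass :=
  le_antisymm ((wLength_bypass_le ω p).trans hp.le) (wDist_le ω _)

/-- A cheaper middle piece would give a cheaper whole walk. -/
theorem IsWGeodesic.middle (hconn : G.Connected) {ω : G.edgeSet → ℝ≥0} {u v w x : V}
    {p₁ : G.Walk u v} {p₂ : G.Walk v w} {p₃ : G.Walk w x}
    (hp : IsWGeodesic ω (p₁.append (p₂.append p₃))) : IsWGeodesic ω p₂ := by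
  refine le_antisymm (le_wDist hconn fun q => ?_) (wDist_le ω _)
  have h := hp.le.trans (wDist_le ω (p₁.append (q.append p₃)))
  simp only [wLength_append] at h
  simpa using h

theorem exists_walk_wLength_eq_sum {σ : ℕ → V} (h : ∀ n, G.Adj (σ n) (σ (n + 1))) (n : ℕ) :
    ∃ p : G.Walk (σ 0) (σ n), ∀ ω : G.edgeSet → ℝ≥0,
      wLength ω p = ∑ i ∈ Finset.range n, ω ⟨s(σ i, σ (i + 1)), h i⟩ := by
  induction n with
  | zero => exact ⟨SimpleGraph.Walk.nil, fun ω => by simp [wLength]⟩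
  | succ n ih =>
    obtain ⟨p, hp⟩ := ih
    refine ⟨p.concat (h n), fun ω => ?_⟩
    rw [SimpleGraph.Walk.concat_eq_append, wLength_append, hp, Finset.sum_range_succ]
    simp [wLength]

theorem wLength_eq_sum (ω : G.edgeSet → ℝ≥0) {u v : V} (p : G.Walk u v) {σ : ℕ → V}
    (hσ : ∀ n, G.Adj (σ n) (σ (n + 1))) (hp : ∀ i ≤ p.length, p.getVert i = σ i) :
    wLength ω p = ∑ i ∈ Finset.range p.length, ω ⟨s(σ i, σ (i + 1)), hσ i⟩ := by
  induction p generalizing σ with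
  | nil => simp [wLength]
  | @cons u v w h p ih =>
    have h0 : u = σ 0 := hp 0 (Nat.zero_le _)
    have h1 : v = σ 1 := by
      have := hp 1 (by simp)
      simpa using this
    subst h0 h1
    have := ih (σ := fun n => σ (n + 1)) (fun n => hσ (n + 1)) fun i hi => by
      have := hp (i + 1) (by simpa using hi)
      simpa using this
    rw [wLength, this, SimpleGraph.Walk.length_cons, Finset.sum_range_succ', add_comm]

/-! ### Counting in graphs of bounded degree -/

theorem BoundedDegree.exists_finset (hdeg : BoundedDegree G) :
    ∃ (q : ℕ) (nb : V → Finset V), (∀ v w, w ∈ nb v ↔ G.Adj v w) ∧ ∀ v, (nb v).card ≤ q := by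
  obtain ⟨q, hq⟩ := hdeg
  have hfin : ∀ v, (G.neighborSet v).Finite := fun v =>
    Set.encard_lt_top_iff.1 ((hq v).trans_lt (ENat.natCast_lt_top q))
  refine ⟨q, fun v => (hfin v).toFinset, fun v w => by simp, fun v => ?_⟩
  have := hq v
  rw [(hfin v).encard_eq_coe_toFinset_card] at this
  exact_mod_cast this

theorem exists_finset_ball (hconn : G.Connected) {q : ℕ} {nb : V → Finset V}
    (hnb : ∀ v w, w ∈ nb v ↔ G.Adj v w) (hq : ∀ v, (nb v).card ≤ q) (o : V) (n : ℕ) :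
    ∃ B : Finset V, (∀ x, G.dist o x ≤ n → x ∈ B) ∧ B.card ≤ (q + 1) ^ n := by
  classical
  induction n with
  | zero =>
    refine ⟨{o}, fun x hx => ?_, by simp⟩
    rw [Finset.mem_singleton, eq_comm, ← hconn.dist_eq_zero_iff]
    omega
  | succ n ih =>
    obtain ⟨B, hB, hcard⟩ := ih
    refine ⟨B.biUnion fun y => insert y (nb y), fun x hx => ?_, ?_⟩
    · rw [Finset.mem_biUnion]
      by_cases hn : G.dist o x ≤ n
      · exact ⟨x, hB x hn, Finset.mem_insert_self _ _⟩
      · obtain ⟨y, hy1, hy2⟩ := exists_between hconn o x (t := n) (by omega)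
        have : G.Adj y x := SimpleGraph.dist_eq_one_iff_adj.1 (by omega)
        exact ⟨y, hB y hy1.le, Finset.mem_insert_of_mem ((hnb y x).2 this)⟩
    · calc (B.biUnion fun y => insert y (nb y)).card ≤ B.card * (q + 1) :=
            Finset.card_biUnion_le_card_mul _ _ _ fun y _ =>
              (Finset.card_insert_le _ _).trans (by have := hq y; omega)
        _ ≤ (q + 1) ^ n * (q + 1) := by gcongr
        _ = _ := (pow_succ _ _).symm

/-- Edge lists rather than walks are counted, so that all endpoints are treated at once and the
lists are fixed before `ω`. -/
theorem exists_finset_edges {q : ℕ} {nb : V → Finset V}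
    (hnb : ∀ v w, w ∈ nb v ↔ G.Adj v w) (hq : ∀ v, (nb v).card ≤ q) (n : ℕ) (x : V) :
    ∃ S : Finset (List G.edgeSet), S.card ≤ q ^ n ∧ ∀ (y : V) (p : G.Walk x y), p.length = n →
      ∃ l ∈ S, l.map Subtype.val = p.edges ∧
        ∀ ω : G.edgeSet → ℝ≥0, wLength ω p = (l.map ω).sum := by
  classical
  induction n generalizing x with
  | zero =>
    refine ⟨{[]}, by simp, fun y p hp => ⟨[], by simp, ?_⟩⟩
    cases p with
    | nil => simp [wLength]
    | cons h p => simp at hp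
  | succ n ih =>
    choose S hcard hS using ih
    refine ⟨(nb x).attach.biUnion fun y =>
      (S y).image (⟨s(x, y), (hnb x y).1 y.2⟩ :: ·), ?_, fun y p hp => ?_⟩
    · calc _ ≤ (nb x).attach.card * q ^ n := Finset.card_biUnion_le_card_mul _ _ _ fun y _ =>
            Finset.card_image_le.trans (hcard y)
        _ ≤ q * q ^ n := by rw [Finset.card_attach]; gcongr; exact hq x
        _ = _ := by ring
    · cases p with
      | nil => simp at hp
      | @cons _ z _ h p =>
        obtain ⟨l, hl, hle, hlw⟩ := hS z y p (by simpa using hp)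
        refine ⟨⟨s(x, z), h⟩ :: l, ?_, by simp [hle], fun ω => by simp [wLength, hlw]⟩
        rw [Finset.mem_biUnion]
        exact ⟨⟨z, (hnb x z).2 h⟩, Finset.mem_attach _ _, Finset.mem_image_of_mem _ hl⟩

end Weights

/-! ### Almost sure estimates -/

section Random

variable {V : Type*} {G : SimpleGraph V} (ν : Measure ℝ≥0) [IsProbabilityMeasure ν]

instance : IsProbabilityMeasure (weightLaw G ν) := by
  unfold weightLaw; infer_instance

theorem measurePreserving_eval_weightLaw (e : G.edgeSet) :
    MeasurePreserving (fun ω : G.edgeSet → ℝ≥0 => ω e) (weightLaw G ν) ν :=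
  measurePreserving_eval_infinitePi _ e

/-- The Laplace transform of `ν`. -/
noncomputable def laplace (M : ℕ) : ℝ≥0∞ := ∫⁻ t, ENNReal.ofReal (Real.exp (-(M * (t : ℝ)))) ∂ν

/-- Dominated convergence: the integrand tends to 0 at every t > 0, hence almost everywhere because
0 is not an atom. -/
theorem tendsto_laplace (hzero : ν {0} = 0) : Tendsto (laplace ν) atTop (nhds 0) := by
  have h : Tendsto (laplace ν) atTop (nhds (∫⁻ _, 0 ∂ν)) := by
    refine tendsto_lintegral_of_dominated_convergence (fun _ => 1) (fun M => by fun_prop)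
      (fun M => Eventually.of_forall fun t => ?_) (by simp) ?_
    · rw [ENNReal.ofReal_le_one, Real.exp_le_one_iff]
      have : (0 : ℝ) ≤ M * t := by positivity
      linarith
    · have : ∀ᵐ t ∂ν, t ≠ 0 := by
        rw [ae_iff]; simpa using hzero
      filter_upwards [this] with t ht
      have ht' : (0 : ℝ) < t := by exact_mod_cast pos_iff_ne_zero.2 ht
      rw [← ENNReal.ofReal_zero]
      refine (ENNReal.continuous_ofReal.tendsto 0).comp ?_
      refine Real.tendsto_exp_atBot.comp (tendsto_neg_atTop_atBot.comp ?_)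
      exact tendsto_natCast_atTop_atTop.atTop_mul_const ht'
  simpa using h

/-- Exponential Markov inequality; since the edges are distinct, independence turns the expectation
into a power of the Laplace transform. -/
theorem measure_mul_sum_le (M : ℕ) (l : List G.edgeSet) (hl : l.Nodup) :
    weightLaw G ν {ω | M * (l.map ω).sum ≤ l.length} ≤
      (ENNReal.ofReal (Real.exp 1) * laplace ν M) ^ l.length := by
  classical
  set f : ℝ≥0 → ℝ≥0∞ := fun t => ENNReal.ofReal (Real.exp (-(M * (t : ℝ)))) with hf
  have hfm : Measurable f := by fun_prop
  have hcard : l.toFinset.card = l.length := List.toFinset_card_of_nodup hl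
  have hprod : ∫⁻ ω, ∏ e ∈ l.toFinset, f (ω e) ∂(weightLaw G ν) = laplace ν M ^ l.length := by
    have h := lintegral_prod_eq_prod_lintegral_of_indepFun (μ := weightLaw G ν) l.toFinset
      (fun e ω => f (ω e)) (iIndepFun_infinitePi fun _ => hfm)
      (fun e => hfm.comp (measurable_pi_apply e))
    rw [h, ← hcard, ← Finset.prod_const]
    refine Finset.prod_congr rfl fun e _ => ?_
    exact (measurePreserving_eval_weightLaw ν e).lintegral_comp hfm
  have hsub : {ω : G.edgeSet → ℝ≥0 | M * (l.map ω).sum ≤ l.length} ⊆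
      {ω | ENNReal.ofReal (Real.exp (-(l.length : ℝ))) ≤ ∏ e ∈ l.toFinset, f (ω e)} := by
    intro ω hω
    have hω' : M * (l.map ω).sum ≤ (l.length : ℝ≥0) := hω
    rw [← List.sum_toFinset _ hl] at hω'
    have hω'' : (M : ℝ) * ∑ e ∈ l.toFinset, (ω e : ℝ) ≤ l.length := by exact_mod_cast hω'
    simp only [Set.mem_ofPred_eq, hf]
    rw [← ENNReal.ofReal_prod_of_nonneg fun _ _ => (Real.exp_pos _).le, ← Real.exp_sum,
      Finset.sum_neg_distrib, ← Finset.mul_sum]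
    gcongr
  have hmarkov := mul_meas_ge_le_lintegral₀ (μ := weightLaw G ν)
    (f := fun ω => ∏ e ∈ l.toFinset, f (ω e))
    (Finset.measurable_prod _ fun e _ => hfm.comp (measurable_pi_apply e)).aemeasurable
    (ENNReal.ofReal (Real.exp (-(l.length : ℝ))))
  rw [hprod] at hmarkov
  have hexp : ENNReal.ofReal (Real.exp 1) ^ l.length *
      ENNReal.ofReal (Real.exp (-(l.length : ℝ))) = 1 := by
    rw [← ENNReal.ofReal_pow (Real.exp_pos _).le, ← Real.exp_nat_mul,
      ← ENNReal.ofReal_mul (Real.exp_pos _).le, ← Real.exp_add]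
    simp
  calc weightLaw G ν {ω | M * (l.map ω).sum ≤ l.length}
      ≤ weightLaw G ν {ω | ENNReal.ofReal (Real.exp (-(l.length : ℝ))) ≤
          ∏ e ∈ l.toFinset, f (ω e)} := measure_mono hsub
    _ = ENNReal.ofReal (Real.exp 1) ^ l.length * (ENNReal.ofReal (Real.exp (-(l.length : ℝ))) *
          weightLaw G ν {ω | ENNReal.ofReal (Real.exp (-(l.length : ℝ))) ≤
          ∏ e ∈ l.toFinset, f (ω e)}) := by rw [← mul_assoc, hexp, one_mul]
    _ ≤ ENNReal.ofReal (Real.exp 1) ^ l.length * laplace ν M ^ l.length := by gcongr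
    _ = _ := (mul_pow _ _ _).symm

/-- Almost surely, all long simple paths starting not too far from `o` have `ω`-length at least
proportional to their number of edges. -/
theorem exists_ae_le_mul_wLength (hconn : G.Connected) (hdeg : BoundedDegree G)
    (hzero : ν {0} = 0) (o : V) :
    ∃ M : ℕ, ∀ᵐ ω ∂(weightLaw G ν), ∀ᶠ n : ℕ in atTop, ∀ x y : V, G.dist o x ≤ 2 * n →
      ∀ p : G.Walk x y, p.IsPath → p.length = n → (n : ℝ≥0) ≤ M * wLength ω p := by
  classical
  obtain ⟨q, nb, hnb, hq⟩ := hdeg.exists_finset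
  choose B hB hBcard using exists_finset_ball hconn hnb hq o
  choose S hScard hS using exists_finset_edges hnb hq
  -- Per unit of n: starting points in a ball of radius 2n, edge lists of length n, and the factor e
  -- from Markov. `M` makes the bad events at most geometric with ratio 1/2, for Borel–Cantelli.
  set A : ℝ≥0∞ := ((q + 1) ^ 2 * q : ℕ) * ENNReal.ofReal (Real.exp 1) with hA
  have hlim : Tendsto (fun M => A * laplace ν M) atTop (nhds 0) := by
    have := ENNReal.Tendsto.const_mul (tendsto_laplace ν hzero) (a := A)
      (Or.inr (ENNReal.mul_ne_top (ENNReal.natCast_ne_top _) ENNReal.ofReal_ne_top))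
    simpa using this
  obtain ⟨M, hM⟩ := (hlim.eventually (gt_mem_nhds (show (0 : ℝ≥0∞) < 2⁻¹ by simp))).exists
  refine ⟨M, ?_⟩
  let T : ℕ → Set (G.edgeSet → ℝ≥0) := fun n =>
    ⋃ x ∈ B (2 * n), ⋃ l ∈ (S n x).filter fun l => l.Nodup ∧ l.length = n,
      {ω | M * (l.map ω).sum ≤ l.length}
  have hT : ∀ n, weightLaw G ν (T n) ≤ 2⁻¹ ^ n := by
    intro n
    calc weightLaw G ν (T n)
        ≤ ∑ x ∈ B (2 * n), ∑ l ∈ (S n x).filter fun l => l.Nodup ∧ l.length = n,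
            weightLaw G ν {ω | M * (l.map ω).sum ≤ l.length} :=
          (measure_biUnion_finset_le _ _).trans
            (Finset.sum_le_sum fun x _ => measure_biUnion_finset_le _ _)
      _ ≤ ∑ x ∈ B (2 * n), ∑ l ∈ (S n x).filter fun l => l.Nodup ∧ l.length = n,
            (ENNReal.ofReal (Real.exp 1) * laplace ν M) ^ n := by
          refine Finset.sum_le_sum fun x _ => Finset.sum_le_sum fun l hl => ?_
          obtain ⟨-, hnd, hlen⟩ := Finset.mem_filter.1 hl
          have := measure_mul_sum_le ν M l hnd
          rwa [hlen] at this ⊢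
      _ ≤ ∑ x ∈ B (2 * n), (q ^ n : ℕ) * (ENNReal.ofReal (Real.exp 1) * laplace ν M) ^ n := by
          refine Finset.sum_le_sum fun x _ => ?_
          rw [Finset.sum_const, nsmul_eq_mul]
          gcongr
          exact (Finset.card_filter_le _ _).trans (hScard n x)
      _ ≤ ((q + 1) ^ (2 * n) : ℕ) *
            ((q ^ n : ℕ) * (ENNReal.ofReal (Real.exp 1) * laplace ν M) ^ n) := by
          rw [Finset.sum_const, nsmul_eq_mul]
          gcongr
          exact hBcard _
      _ = (A * laplace ν M) ^ n := by
          rw [hA]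
          push_cast
          rw [pow_mul, ← mul_pow, ← mul_pow]
          congr 1
          ring
      _ ≤ 2⁻¹ ^ n := by gcongr
  have hsum : ∑' n, weightLaw G ν (T n) ≠ ∞ := by
    refine ne_top_of_le_ne_top ?_ (ENNReal.tsum_le_tsum hT)
    rw [ENNReal.tsum_geometric]
    simp
  filter_upwards [ae_eventually_notMem hsum] with ω hω
  filter_upwards [hω] with n hn x y hx p hp hlen
  by_contra hlt
  obtain ⟨l, hl, hle, hlw⟩ := hS n x y p hlen
  have hlen' : l.length = n := by
    rw [← hlen, ← p.length_edges, ← hle, List.length_map]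
  apply hn
  simp only [T, Set.mem_iUnion, Finset.mem_filter, Set.mem_ofPred_eq]
  refine ⟨x, hB _ x hx, l, ⟨hl, ?_, hlen'⟩, ?_⟩
  · exact List.Nodup.of_map Subtype.val (hle ▸ hp.isTrail.edges_nodup)
  · rw [← hlw, hlen']
    exact (not_le.1 hlt).le

/-! ### Linear upper bounds from the finite mean -/

theorem exists_forall_le_of_eventually_le {f g : ℕ → ℝ≥0} (h : ∀ᶠ n in atTop, f n ≤ g n) :
    ∃ c, ∀ n, f n ≤ g n + c := by
  obtain ⟨N, hN⟩ := eventually_atTop.1 h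
  refine ⟨∑ n ∈ Finset.range N, f n, fun n => ?_⟩
  rcases lt_or_ge n N with hn | hn
  · exact (Finset.single_le_sum (f := f) (fun _ _ => zero_le) (Finset.mem_range.2 hn)).trans
      le_add_self
  · exact (hN n hn).trans le_self_add

theorem tsum_measure_lt_mul_lt_top (hmean : ∫⁻ t, (t : ℝ≥0∞) ∂ν < ∞) (m : ℕ) :
    ∑' n : ℕ, ν {t | (n : ℝ≥0) < m * t} < ∞ := by
  -- `tsum_prob_mem_Ioi_lt_top` concerns the canonical measure of the space, so ν is installed as
  -- that measure.
  let _ : MeasureSpace ℝ≥0 := ⟨ν⟩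
  have hint : Integrable (fun t : ℝ≥0 => (m : ℝ) * t) ν := by
    refine Integrable.const_mul ⟨by fun_prop, ?_⟩ _
    simpa [HasFiniteIntegral, enorm_eq_nnnorm] using hmean
  have h := tsum_prob_mem_Ioi_lt_top (Ω := ℝ≥0) (X := fun t => (m : ℝ) * t) hint
    (fun t => by positivity)
  refine lt_of_le_of_lt (ENNReal.tsum_le_tsum fun n => measure_mono fun t ht => ?_) h
  have ht' : (n : ℝ≥0) < m * t := ht
  simp only [Set.mem_ofPred_eq, Set.mem_Ioi]
  exact_mod_cast ht'

/-- By Borel–Cantelli, for large n each of the at most m weights in `F n` is at most n/m. The slope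
is 1 whatever `m` is. -/
theorem ae_exists_sum_le (hmean : ∫⁻ t, (t : ℝ≥0∞) ∂ν < ∞) {m : ℕ}
    (F : ℕ → Finset G.edgeSet) (hF : ∀ n, (F n).card ≤ m) :
    ∀ᵐ ω ∂(weightLaw G ν), ∃ c : ℝ≥0, ∀ n, ∑ e ∈ F n, ω e ≤ n + c := by
  let T : ℕ → Set (G.edgeSet → ℝ≥0) := fun n => ⋃ e ∈ F n, {ω | (n : ℝ≥0) < m * ω e}
  have hT : ∀ n, weightLaw G ν (T n) ≤ m * ν {t | (n : ℝ≥0) < m * t} := by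
    intro n
    calc weightLaw G ν (T n) ≤ ∑ e ∈ F n, weightLaw G ν {ω | (n : ℝ≥0) < m * ω e} :=
          measure_biUnion_finset_le _ _
      _ = ∑ e ∈ F n, ν {t | (n : ℝ≥0) < m * t} := by
          refine Finset.sum_congr rfl fun e _ => ?_
          exact (measurePreserving_eval_weightLaw ν e).measure_preimage
            (measurableSet_lt measurable_const (measurable_const.mul measurable_id)).nullMeasurableSet
      _ ≤ m * ν {t | (n : ℝ≥0) < m * t} := by
          rw [Finset.sum_const, nsmul_eq_mul]
          gcongr
          exact hF n
  have hsum : ∑' n, weightLaw G ν (T n) ≠ ∞ := by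
    refine ne_top_of_le_ne_top ?_ (ENNReal.tsum_le_tsum hT)
    rw [ENNReal.tsum_mul_left]
    exact ENNReal.mul_ne_top (ENNReal.natCast_ne_top _) (tsum_measure_lt_mul_lt_top ν hmean m).ne
  filter_upwards [ae_eventually_notMem hsum] with ω hω
  refine exists_forall_le_of_eventually_le ?_
  filter_upwards [hω] with n hn
  simp only [T, Set.mem_iUnion, Set.mem_ofPred_eq, not_exists, not_lt] at hn
  rcases Nat.eq_zero_or_pos m with rfl | hm
  · have : F n = ∅ := by simpa using hF n
    simp [this]
  · have hm' : (0 : ℝ≥0) < m := by exact_mod_cast hm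
    have h1 : m * ∑ e ∈ F n, ω e ≤ m * (n : ℝ≥0) := by
      rw [Finset.mul_sum]
      refine (Finset.sum_le_sum hn).trans ?_
      rw [Finset.sum_const, nsmul_eq_mul]
      gcongr
      exact hF n
    exact le_of_mul_le_mul_left h1 hm'

/-- Almost surely, the `ω`-diameter of the balls of radius `R` around `σ n` is at most
linear in `n`. -/
theorem ae_exists_wDist_le (hconn : G.Connected) (hdeg : BoundedDegree G)
    (hmean : ∫⁻ t, (t : ℝ≥0∞) ∂ν < ∞) (σ : ℕ → V) (R : ℕ) :
    ∀ᵐ ω ∂(weightLaw G ν), ∃ c : ℝ≥0, ∀ n x, G.dist (σ n) x ≤ R → wDist ω (σ n) x ≤ n + c := by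
  classical
  obtain ⟨q, nb, hnb, hq⟩ := hdeg.exists_finset
  choose B hB hBcard using fun o => exists_finset_ball hconn hnb hq o R
  choose S hScard hS using exists_finset_edges hnb hq
  choose p hpp hp using fun n x => hconn.exists_path_of_dist (σ n) x
  choose l hl hle hlw using fun n x => hS _ _ _ (p n x) rfl
  let F : ℕ → Finset G.edgeSet := fun n =>
    ((B (σ n)).filter fun x => G.dist (σ n) x ≤ R).biUnion fun x => (l n x).toFinset
  have hF : ∀ n, (F n).card ≤ (q + 1) ^ R * R := by
    intro n
    refine (Finset.card_biUnion_le_card_mul _ _ R fun x hx => ?_).trans ?_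
    · refine (List.toFinset_card_le _).trans ?_
      have h1 : (l n x).length = (p n x).length := by
        rw [← (p n x).length_edges, ← hle, List.length_map]
      rw [h1, hp]
      exact (Finset.mem_filter.1 hx).2
    · gcongr
      exact (Finset.card_filter_le _ _).trans (hBcard _)
  filter_upwards [ae_exists_sum_le ν hmean F hF] with ω ⟨c, hc⟩
  refine ⟨c, fun n x hx => (wDist_le ω (p n x)).trans ?_⟩
  have hnd : (l n x).Nodup := List.Nodup.of_map Subtype.val (hle n x ▸ (hpp n x).isTrail.edges_nodup)
  rw [hlw, ← List.sum_toFinset _ hnd]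
  refine (Finset.sum_le_sum_of_subset ?_).trans (hc n)
  exact Finset.subset_biUnion_of_mem (fun x => (l n x).toFinset)
    (Finset.mem_filter.2 ⟨hB _ x hx, hx⟩)

theorem exists_ae_sum_le_of_injective (hmean : ∫⁻ t, (t : ℝ≥0∞) ∂ν < ∞) :
    ∃ C : ℕ, ∀ e : ℕ → G.edgeSet, Function.Injective e →
      ∀ᵐ ω ∂(weightLaw G ν), ∃ c : ℝ≥0, ∀ n : ℕ, ∑ i ∈ Finset.range n, ω (e i) ≤ C * n + c := by
  have hint : Integrable (fun t : ℝ≥0 => (t : ℝ)) ν := by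
    refine ⟨by fun_prop, ?_⟩
    simpa [HasFiniteIntegral, enorm_eq_nnnorm] using hmean
  obtain ⟨C, hC⟩ := exists_nat_gt (∫ t : ℝ≥0, (t : ℝ) ∂ν)
  refine ⟨C, fun e he => ?_⟩
  have hident : ∀ i, IdentDistrib (fun ω : G.edgeSet → ℝ≥0 => (ω (e i) : ℝ))
      (fun t : ℝ≥0 => (t : ℝ)) (weightLaw G ν) ν := fun i => by
    have hmp := measurePreserving_eval_weightLaw ν (e i)
    refine ⟨(measurable_coe_nnreal_real.comp hmp.measurable).aemeasurable,
      measurable_coe_nnreal_real.aemeasurable, ?_⟩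
    have h := Measure.map_map (μ := weightLaw G ν) (g := fun t : ℝ≥0 => (t : ℝ))
      (f := fun ω => ω (e i)) (by fun_prop) (by fun_prop)
    rw [hmp.map_eq] at h
    exact h.symm
  have hindep : iIndepFun (fun (d : G.edgeSet) (ω : G.edgeSet → ℝ≥0) => (ω d : ℝ))
      (weightLaw G ν) :=
    iIndepFun_infinitePi (X := fun _ (t : ℝ≥0) => (t : ℝ)) fun _ => by fun_prop
  have hlln := strong_law_ae_real (μ := weightLaw G ν) (fun i ω => (ω (e i) : ℝ))
    ((hident 0).integrable_iff.2 hint) (fun i j hij => hindep.indepFun (he.ne hij))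
    (fun i => (hident i).trans (hident 0).symm)
  filter_upwards [hlln] with ω hω
  refine exists_forall_le_of_eventually_le ?_
  rw [(hident 0).integral_eq] at hω
  filter_upwards [hω.eventually (gt_mem_nhds hC), eventually_gt_atTop 0] with n hn hpos
  rw [div_lt_iff₀ (by exact_mod_cast hpos)] at hn
  exact_mod_cast hn.le

theorem sum_range_mul_eq (f : ℕ → ℝ≥0) (m n : ℕ) :
    ∑ i ∈ Finset.range (m * n), f i =
      ∑ r ∈ Finset.range m, ∑ j ∈ Finset.range n, f (m * j + r) := by
  induction n with
  | zero => simp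
  | succ n ih =>
    rw [mul_add_one, Finset.sum_range_add, ih, ← Finset.sum_add_distrib]
    simp only [Finset.sum_range_succ]

/-- An edge recurs only within a window of m indices, so along each residue class mod m the edges
are distinct and the strong law applies. Summing the m classes keeps the slope `C`, independent of
`m`. -/
theorem exists_ae_sum_le (hmean : ∫⁻ t, (t : ℝ≥0∞) ∂ν < ∞) :
    ∃ C : ℕ, ∀ (e : ℕ → G.edgeSet) (m : ℕ), (∀ i j, e i = e j → j < i + m) →
      ∀ᵐ ω ∂(weightLaw G ν), ∃ c : ℝ≥0, ∀ n : ℕ, ∑ i ∈ Finset.range n, ω (e i) ≤ C * n + c := by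
  obtain ⟨C, hC⟩ := exists_ae_sum_le_of_injective (G := G) ν hmean
  refine ⟨C, fun e m hm => ?_⟩
  have hmpos : 0 < m := by have := hm 0 0 rfl; omega
  have hinj : ∀ r, Function.Injective fun j => e (m * j + r) := by
    intro r i j hij
    have h1 := hm _ _ hij
    have h2 := hm _ _ hij.symm
    have h3 : m * j < m * (i + 1) := by rw [mul_add_one]; omega
    have h4 : m * i < m * (j + 1) := by rw [mul_add_one]; omega
    have h5 := lt_of_mul_lt_mul_left h3 (Nat.zero_le _)
    have h6 := lt_of_mul_lt_mul_left h4 (Nat.zero_le _)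
    omega
  have hall := ae_all_iff.2 fun r => hC _ (hinj r)
  filter_upwards [hall] with ω hω
  choose c hc using hω
  refine ⟨C * m + ∑ r ∈ Finset.range m, c r, fun n => ?_⟩
  have hn : n ≤ m * (n / m + 1) := (Nat.lt_mul_div_succ n hmpos).le
  have hn' : m * (n / m + 1) ≤ n + m := by
    rw [mul_add_one]; have := Nat.mul_div_le n m; omega
  calc ∑ i ∈ Finset.range n, ω (e i)
      ≤ ∑ i ∈ Finset.range (m * (n / m + 1)), ω (e i) :=
        Finset.sum_le_sum_of_subset (by simpa using hn)
    _ = ∑ r ∈ Finset.range m, ∑ j ∈ Finset.range (n / m + 1), ω (e (m * j + r)) :=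
        sum_range_mul_eq _ _ _
    _ ≤ ∑ r ∈ Finset.range m, (C * ((n / m + 1 : ℕ) : ℝ≥0) + c r) :=
        Finset.sum_le_sum fun r _ => hc r _
    _ = C * ((m * (n / m + 1) : ℕ) : ℝ≥0) + ∑ r ∈ Finset.range m, c r := by
        rw [Finset.sum_add_distrib, Finset.sum_const, Finset.card_range, nsmul_eq_mul]
        push_cast
        ring
    _ ≤ C * ((n + m : ℕ) : ℝ≥0) + ∑ r ∈ Finset.range m, c r := by gcongr
    _ = _ := by push_cast; ring

/-- Almost surely, the `ω`-length of an initial segment of a quasi-geodesic ray is at most linear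
in its number of edges, with a constant that depends only on `ν`. -/
theorem exists_ae_wDist_le (hmean : ∫⁻ t, (t : ℝ≥0∞) ∂ν < ∞) :
    ∃ C : ℕ, ∀ (σ : ℕ → V) (m : ℕ), (∀ n, G.Adj (σ n) (σ (n + 1))) →
      (∀ i j, G.dist (σ i) (σ j) ≤ 1 → j < i + m) →
      ∀ᵐ ω ∂(weightLaw G ν), ∃ c : ℝ≥0, ∀ n : ℕ, wDist ω (σ 0) (σ n) ≤ C * n + c := by
  obtain ⟨C, hC⟩ := exists_ae_sum_le (G := G) ν hmean
  refine ⟨C, fun σ m hσ hm => ?_⟩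
  have hrep : ∀ i j, (⟨s(σ i, σ (i + 1)), hσ i⟩ : G.edgeSet) = ⟨s(σ j, σ (j + 1)), hσ j⟩ →
      j < i + m := by
    intro i j hij
    apply hm
    have h := Subtype.ext_iff.1 hij
    rw [Sym2.eq_iff] at h
    rcases h with ⟨h, -⟩ | ⟨-, h⟩
    · rw [h]; simp
    · rw [← h]; exact (SimpleGraph.dist_eq_one_iff_adj.2 (hσ i)).le
  filter_upwards [hC _ m hrep] with ω ⟨c, hc⟩
  refine ⟨c, fun n => ?_⟩
  obtain ⟨p, hp⟩ := exists_walk_wLength_eq_sum hσ n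
  exact (wDist_le ω p).trans ((hp ω).le.trans (hc n))

end Random

/-! ### Confinement of `ω`-geodesics and the limiting bi-infinite geodesic -/

section Main

variable {V : Type*} {G : SimpleGraph V}

theorem dist_getVert_le {x y : V} (p : G.Walk x y) {s t : ℕ} (hst : s ≤ t)
    (ht : t ≤ p.length) : G.dist (p.getVert s) (p.getVert t) ≤ t - s := by
  obtain ⟨-, q, -, -, hq, -⟩ := exists_append_append p hst ht
  exact hq ▸ G.dist_le q

/-- Simple paths with at least n edges weigh no less than a reference walk `p₀`, and shorter walks
take finitely many weights, so the infimum is attained. -/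
theorem exists_isWGeodesic (hconn : G.Connected) (hdeg : BoundedDegree G) {o : V}
    {ω : G.edgeSet → ℝ≥0} {M : ℕ}
    (hω : ∀ᶠ n : ℕ in atTop, ∀ x y : V, G.dist o x ≤ 2 * n →
      ∀ p : G.Walk x y, p.IsPath → p.length = n → (n : ℝ≥0) ≤ M * wLength ω p) (x y : V) :
    ∃ p : G.Walk x y, IsWGeodesic ω p := by
  classical
  obtain ⟨q, nb, hnb, hq⟩ := hdeg.exists_finset
  choose S hScard hS using exists_finset_edges hnb hq
  obtain ⟨p₀⟩ := hconn.preconnected x y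
  obtain ⟨k, hk⟩ := exists_nat_gt (M * wLength ω p₀)
  obtain ⟨n, hn, hnx, hnk⟩ := (hω.and ((eventually_ge_atTop (G.dist o x)).and
    (eventually_ge_atTop k))).exists
  have hlong : ∀ p : G.Walk x y, p.IsPath → n ≤ p.length → wLength ω p₀ ≤ wLength ω p := by
    intro p hp hlen
    by_contra hlt
    have h1 := hn x _ (by omega) (p.take n) (hp.take n)
      (by rw [SimpleGraph.Walk.take_length]; omega)
    have h2 := congrArg (wLength ω) (p.append_take_drop_eq n)
    rw [wLength_append] at h2
    have h3 : (n : ℝ≥0) ≤ M * wLength ω p₀ := by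
      refine h1.trans ?_
      gcongr
      exact (le_self_add.trans h2.le).trans (not_le.1 hlt).le
    have h4 : (k : ℝ≥0) ≤ n := by exact_mod_cast hnk
    exact absurd (h4.trans h3) (not_le.2 hk)
  let T : Set ℝ≥0 := {r | ∃ p : G.Walk x y, wLength ω p = r ∧ p.length < n}
  have hT : T.Finite := by
    refine (((Finset.range n).biUnion fun i =>
      (S i x).image fun l => (l.map ω).sum).finite_toSet).subset ?_
    rintro r ⟨p, rfl, hp⟩
    obtain ⟨l, hl, -, hlw⟩ := hS _ x y p rfl
    simp only [Finset.coe_biUnion, Set.mem_iUnion, Finset.mem_coe]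
    exact ⟨p.length, Finset.mem_range.2 hp, Finset.mem_image.2 ⟨l, hl, (hlw ω).symm⟩⟩
  by_cases hne : T.Nonempty
  · obtain ⟨r, ⟨p, hpr, -⟩, hmin⟩ := Set.exists_min_image T id hT hne
    by_cases hp₀ : wLength ω p₀ ≤ r
    · refine ⟨p₀, le_antisymm (le_wDist hconn fun p' => ?_) (wDist_le ω _)⟩
      refine le_trans ?_ (wLength_bypass_le ω p')
      rcases lt_or_ge p'.bypass.length n with h | h
      · exact hp₀.trans (hmin _ ⟨_, rfl, h⟩)
      · exact hlong _ p'.bypass_isPath h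
    · refine ⟨p, le_antisymm (le_wDist hconn fun p' => ?_) (wDist_le ω _)⟩
      refine le_trans ?_ (wLength_bypass_le ω p')
      rw [hpr]
      rcases lt_or_ge p'.bypass.length n with h | h
      · exact hmin _ ⟨_, rfl, h⟩
      · exact (not_le.1 hp₀).le.trans (hlong _ p'.bypass_isPath h)
  · refine ⟨p₀, le_antisymm (le_wDist hconn fun p' => ?_) (wDist_le ω _)⟩
    refine le_trans ?_ (wLength_bypass_le ω p')
    refine hlong _ p'.bypass_isPath (not_lt.1 fun h => hne ⟨_, _, rfl, h⟩)

theorem IsBiPath.dist_le {γ : ℤ → V} (h : IsBiPath G γ) (i j : ℤ) :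
    G.dist (γ i) (γ j) ≤ (j - i).natAbs := by
  obtain ⟨p, hp, -⟩ := h.exists_walk_natAbs i j
  exact hp ▸ G.dist_le p

/-- Almost surely, all `ω`-geodesics between the two ends of a quasi-geodesic meet a fixed ball. -/
theorem ae_exists_forall_dist_le (hconn : G.Connected) (hdeg : BoundedDegree G) {δ : ℕ}
    (hδ : Thin G δ) (ν : Measure ℝ≥0) [IsProbabilityMeasure ν]
    (hmean : ∫⁻ t, (t : ℝ≥0∞) ∂ν < ∞) (hzero : ν {0} = 0) {γ : ℤ → V} {C K : ℕ}
    (hγ : IsQuasiGeodesic G γ C K) :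
    ∀ᵐ ω ∂(weightLaw G ν), ∃ m : ℕ, ∀ a b : ℤ, a ≤ 0 → 0 ≤ b →
      (∃ p : G.Walk (γ a) (γ b), IsWGeodesic ω p) ∧
      ∀ p : G.Walk (γ a) (γ b), IsWGeodesic ω p → ∃ v ∈ p.support, G.dist (γ 0) v ≤ m := by
  classical
  obtain ⟨M, hM⟩ := exists_ae_le_mul_wLength (G := G) ν hconn hdeg hzero (γ 0)
  obtain ⟨D, hD⟩ := exists_ae_wDist_le (G := G) ν hmean
  -- `D` is the slope along γ and the extra 1 the slope for entering and leaving its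
  -- R-neighbourhood. The factor 2 leaves half of n to spare, and the final + 1 keeps L positive
  -- even if `M = 0`.
  obtain ⟨R, Q, hRQ⟩ := hγ.exists_crossing hconn hδ (2 * M * (D + 1) + 1)
  have hpos := hD (fun n : ℕ => γ n) (C + K + 1) (fun n => by simpa using hγ.1 n) fun i j hij => by
    have := (le_abs_self _).trans (hγ.abs_sub_le hij)
    push_cast at this
    omega
  have hneg := hD (fun n : ℕ => γ (-n)) (C + K + 1)
    (fun n => by
      have h := hγ.1 (-((n + 1 : ℕ) : ℤ))
      rw [show -((n + 1 : ℕ) : ℤ) + 1 = -n by push_cast; ring] at h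
      exact h.symm)
    fun i j hij => by
      have := (neg_le_abs _).trans (hγ.abs_sub_le hij)
      push_cast at this
      omega
  filter_upwards [hM, hpos, hneg, ae_exists_wDist_le ν hconn hdeg hmean (fun n : ℕ => γ n) R,
    ae_exists_wDist_le ν hconn hdeg hmean (fun n : ℕ => γ (-n)) R]
    with ω hlow ⟨c₁, hc₁⟩ ⟨c₂, hc₂⟩ ⟨c₃, hc₃⟩ ⟨c₄, hc₄⟩
  simp only [Nat.cast_zero, neg_zero] at hc₁ hc₂
  obtain ⟨N, hN⟩ := eventually_atTop.1 hlow
  obtain ⟨k₀, hk₀⟩ := exists_nat_ge (2 * M * (c₁ + c₂ + c₃ + c₄))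
  set n₀ := N + Q + R + k₀ with hn₀
  refine ⟨n₀ + Q + R, fun a b ha hb => ⟨exists_isWGeodesic hconn hdeg hlow _ _, fun p hp => ?_⟩⟩
  -- The lower bound on weights holds for simple paths only, hence the passage to `bypass`.
  suffices ∃ v ∈ p.bypass.support, G.dist (γ 0) v ≤ n₀ + Q + R by
    obtain ⟨v, hv, hd⟩ := this
    exact ⟨v, p.support_bypass_subset_support hv, hd⟩
  obtain ⟨s, t, k, l, hst, ht, hk, hl, hdk, hdl, hL⟩ := hRQ a b ha hb p.bypass
  refine ⟨_, p.bypass.getVert_mem_support s, ?_⟩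
  obtain ⟨i, rfl⟩ : ∃ i : ℕ, k = -i := ⟨k.natAbs, by omega⟩
  obtain ⟨j, rfl⟩ : ∃ j : ℕ, l = j := ⟨l.natAbs, by omega⟩
  obtain ⟨p₁, p₂, p₃, hpp, hlen, -⟩ := exists_append_append p.bypass hst ht
  have hgeo : IsWGeodesic ω p₂ := by
    have := hp.bypass
    rw [hpp] at this
    exact this.middle hconn
  have hpath : p₂.IsPath := by
    have := p.bypass_isPath
    rw [hpp] at this
    exact this.of_append_right.of_append_left
  generalize p.bypass.getVert s = x at *
  generalize p.bypass.getVert t = y at *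
  set n := t - s with hn
  have hL' : (2 * M * (D + 1) + 1) * (j + i) ≤ n + Q := by
    have : ((2 * M * (D + 1) + 1 : ℕ) : ℤ) * ((j : ℤ) - -i) ≤ n + Q := hL
    rw [sub_neg_eq_add] at this
    exact_mod_cast this
  have hij : j + i ≤ n + Q := (Nat.le_mul_of_pos_left _ (by omega)).trans hL'
  have hdx : G.dist (γ 0) x ≤ i + R := by
    have h1 := hconn.dist_triangle (u := γ 0) (v := γ (-i)) (w := x)
    have h2 := hγ.1.dist_le 0 (-i)
    rw [G.dist_comm (u := γ (-i)) (v := x)] at h1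
    omega
  suffices n ≤ n₀ by omega
  by_contra hlt
  have h1 : (n : ℝ≥0) ≤ M * wLength ω p₂ := hN n (by omega) x y (by omega) p₂ hpath hlen
  have h2 : wLength ω p₂ ≤ (D + 1) * ((j + i : ℕ) : ℝ≥0) + (c₁ + c₂ + c₃ + c₄) := by
    have e1 := wDist_triangle hconn ω x (γ (-i)) y
    have e2 := wDist_triangle hconn ω (γ (-i)) (γ 0) y
    have e3 := wDist_triangle hconn ω (γ 0) (γ j) y
    have e4 := hc₄ i x (by rw [G.dist_comm]; exact hdk)
    have e5 := hc₂ i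
    have e6 := hc₁ j
    have e7 := hc₃ j y (by rw [G.dist_comm]; exact hdl)
    rw [wDist_comm hconn ω x (γ (-i))] at e1
    rw [wDist_comm hconn ω (γ (-i)) (γ 0)] at e2
    rw [hgeo]
    calc wDist ω x y ≤ ((i : ℝ≥0) + c₄) + ((D * i + c₂) + ((D * j + c₁) + (j + c₃))) :=
          e1.trans (add_le_add e4 (e2.trans (add_le_add e5 (e3.trans (add_le_add e6 e7)))))
      _ = _ := by push_cast; ring
  -- Lower bound against detour along γ: the choice of L bounds the linear part of the cost by n +
  -- Q, which forces n ≤ Q + k₀.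
  have h3 : (n : ℝ≥0) + n ≤ n + (Q + k₀ : ℕ) := by
    calc (n : ℝ≥0) + n ≤ M * wLength ω p₂ + M * wLength ω p₂ := add_le_add h1 h1
      _ = 2 * M * wLength ω p₂ := by ring
      _ ≤ 2 * M * ((D + 1) * ((j + i : ℕ) : ℝ≥0) + (c₁ + c₂ + c₃ + c₄)) := by gcongr
      _ = ((2 * M * (D + 1) * (j + i) : ℕ) : ℝ≥0) + 2 * M * (c₁ + c₂ + c₃ + c₄) := by
          push_cast; ring
      _ ≤ ((n + Q : ℕ) : ℝ≥0) + k₀ := by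
          gcongr
          refine le_trans ?_ hL'
          gcongr
          omega
      _ = _ := by push_cast; ring
  have h4 : n + n ≤ n + (Q + k₀) := by exact_mod_cast h3
  omega

theorem IsBiGeodesic.isQuasiGeodesic {γ : ℤ → V} (h : IsBiGeodesic G γ) :
    IsQuasiGeodesic G γ 1 0 := by
  refine ⟨h.1, fun i j => ?_⟩
  rcases le_total i j with hij | hij
  · have := h.2 i j hij
    push_cast
    omega
  · push_cast
    omega

theorem sum_Ico_int_eq_sum_range (f : ℤ → ℝ≥0) (i : ℤ) (n : ℕ) :
    ∑ k ∈ Finset.Ico i (i + n), f k = ∑ r ∈ Finset.range n, f (i + r) := by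
  refine Finset.sum_nbij' (fun k => (k - i).toNat) (fun r => i + r) ?_ ?_ ?_ ?_ ?_
  · intro k hk
    rw [Finset.mem_Ico] at hk
    rw [Finset.mem_range]
    omega
  · intro r hr
    rw [Finset.mem_range] at hr
    rw [Finset.mem_Ico]
    omega
  · intro k hk
    rw [Finset.mem_Ico] at hk
    omega
  · intro r _
    omega
  · intro k hk
    rw [Finset.mem_Ico] at hk
    congr 1
    omega

/-- If the `ω`-geodesics between the two ends of a bi-infinite geodesic meet a fixed ball, then
they accumulate to a bi-infinite `ω`-geodesic. -/
theorem IsBiGeodesic.exists_isBiWGeodesic (hconn : G.Connected) (hdeg : BoundedDegree G)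
    {γ : ℤ → V} (hγ : IsBiGeodesic G γ) {ω : G.edgeSet → ℝ≥0} {m : ℕ}
    (hm : ∀ a b : ℤ, a ≤ 0 → 0 ≤ b → (∃ p : G.Walk (γ a) (γ b), IsWGeodesic ω p) ∧
      ∀ p : G.Walk (γ a) (γ b), IsWGeodesic ω p → ∃ v ∈ p.support, G.dist (γ 0) v ≤ m) :
    ∃ τ : ℤ → V, IsBiWGeodesic ω τ := by
  classical
  obtain ⟨q, nb, hnb, hq⟩ := hdeg.exists_finset
  have hgood : ∀ n : ℕ, ∃ (p : G.Walk (γ (-n)) (γ n)) (s : ℕ), IsWGeodesic ω p ∧ s ≤ p.length ∧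
      n ≤ s + m ∧ s + n ≤ p.length + m ∧ G.dist (γ 0) (p.getVert s) ≤ m := by
    intro n
    obtain ⟨⟨p, hp⟩, hv⟩ := hm (-n) n (by omega) (by omega)
    obtain ⟨v, hv, hd⟩ := hv p hp
    obtain ⟨s, rfl, hs⟩ := SimpleGraph.Walk.mem_support_iff_exists_getVert.1 hv
    have h1 := dist_getVert_le p (Nat.zero_le s) hs
    have h2 := dist_getVert_le p hs le_rfl
    rw [SimpleGraph.Walk.getVert_zero] at h1
    rw [SimpleGraph.Walk.getVert_length] at h2
    have h3 := hγ.2 (-n) 0 (by omega)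
    have h4 := hγ.2 0 n (by omega)
    have h5 := hconn.dist_triangle (u := γ (-n)) (v := p.getVert s) (w := γ 0)
    have h6 := hconn.dist_triangle (u := γ 0) (v := p.getVert s) (w := γ n)
    rw [G.dist_comm (u := p.getVert s) (v := γ 0)] at h5
    exact ⟨p, s, hp, hs, by omega, by omega, hd⟩
  choose p s hp hs hleft hright hd using hgood
  -- The path re-centred at its vertex near `γ 0`. Both ends are at least n - m steps away, so the
  -- truncation in `toNat` plays no role once n ≥ m + |k|.
  let f : ℕ → ℤ → V := fun n k => (p n).getVert (s n + k).toNat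
  have hU : ∀ N : ℕ, ∀ᶠ n in (hyperfilter ℕ : Filter ℕ), N ≤ n := fun N =>
    Nat.hyperfilter_le_atTop (eventually_ge_atTop N)
  -- For fixed k the vertices `f n k` eventually lie in one finite ball, so the ultrafilter selects
  -- a single vertex; this replaces a diagonal extraction.
  have hlim : ∀ k : ℤ, ∃ v, ∀ᶠ n in (hyperfilter ℕ : Filter ℕ), f n k = v := by
    intro k
    obtain ⟨B, hB, -⟩ := exists_finset_ball hconn hnb hq (γ 0) (m + k.natAbs)
    have hmem : ∀ᶠ n in (hyperfilter ℕ : Filter ℕ), ∃ v ∈ (B : Set V), f n k = v := by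
      filter_upwards [hU (m + k.natAbs)] with n hn
      have h1 := hleft n
      have h2 := hright n
      refine ⟨_, hB _ ?_, rfl⟩
      have h3 : G.dist ((p n).getVert (s n)) (f n k) ≤ k.natAbs := by
        rcases le_total 0 k with hk | hk
        · exact (dist_getVert_le (p n) (by omega) (by omega)).trans (by omega)
        · rw [G.dist_comm]
          exact (dist_getVert_le (p n) (by omega) (hs n)).trans (by omega)
      have h4 := hconn.dist_triangle (u := γ 0) (v := (p n).getVert (s n)) (w := f n k)
      have h5 := hd n
      omega
    obtain ⟨v, -, hv⟩ := (Ultrafilter.eventually_exists_mem_iff B.finite_toSet).1 hmem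
    exact ⟨v, hv⟩
  choose τ hτ using hlim
  have hpath : IsBiPath G τ := by
    intro k
    obtain ⟨n, hn, h1, h2⟩ := ((hU (m + k.natAbs + 1)).and ((hτ k).and (hτ (k + 1)))).exists
    have h3 := hleft n
    have h4 := hright n
    rw [← h1, ← h2]
    have h5 := (p n).adj_getVert_succ (i := (s n + k).toNat) (by omega)
    rwa [show (s n + k).toNat + 1 = (s n + (k + 1)).toNat by omega] at h5
  refine ⟨τ, hpath, fun i j hij => ?_⟩
  obtain ⟨r, rfl⟩ : ∃ r : ℕ, j = i + r := ⟨(j - i).toNat, by omega⟩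
  have hall : ∀ᶠ n in (hyperfilter ℕ : Filter ℕ), ∀ k ∈ Finset.Icc i (i + r), f n k = τ k :=
    (Finset.eventually_all _).2 fun k _ => hτ k
  obtain ⟨n, hn, hf⟩ := ((hU (m + i.natAbs + r)).and hall).exists
  have h3 := hleft n
  have h4 := hright n
  obtain ⟨p₁, p₂, p₃, hpp, hlen, hv⟩ := exists_append_append (p n)
    (s := (s n + i).toNat) (t := (s n + (i + r)).toNat) (by omega) (by omega)
  have hgeo : IsWGeodesic ω p₂ := by
    have := hp n
    rw [hpp] at this
    exact this.middle hconn
  have hlen' : p₂.length = r := by omega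
  have hi : (p n).getVert (s n + i).toNat = τ i := hf i (by rw [Finset.mem_Icc]; omega)
  have hj : (p n).getVert (s n + (i + r)).toNat = τ (i + r) :=
    hf (i + r) (by rw [Finset.mem_Icc]; omega)
  have hsum := wLength_eq_sum ω p₂ (σ := fun a => τ (i + a))
    (fun a => by have := hpath (i + a); push_cast; rwa [← add_assoc])
    (fun a ha => by
      rw [hv a (by omega), ← hf (i + a) (by rw [Finset.mem_Icc]; omega)]
      congr 1
      omega)
  rw [hgeo, hlen', hi, hj] at hsum
  rw [hsum, sum_Ico_int_eq_sum_range fun k => ω ⟨s(τ k, τ (k + 1)), hpath k⟩]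
  refine Finset.sum_congr rfl fun a _ => ?_
  congr 3
  push_cast
  rw [add_assoc]

end Main

end FPP

theorem mainTheorem2 {V : Type*} (G : SimpleGraph V) (hconn : G.Connected)
    (hdeg : FPP.BoundedDegree G) (hhyp : FPP.IsHyperbolic G)
    (hgeo : ∃ γ : ℤ → V, FPP.IsBiGeodesic G γ)
    (ν : Measure ℝ≥0) [IsProbabilityMeasure ν]
    (hmean : ∫⁻ t, (t : ℝ≥0∞) ∂ν < ∞) (hzero : ν {0} = 0) :
    (∀ᵐ ω ∂(FPP.weightLaw G ν), ∃ γ : ℤ → V, FPP.IsBiWGeodesic ω γ) ∧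
    (∀ γ : ℤ → V, FPP.IsBiQuasiGeodesic G γ →
      ∀ᵐ ω ∂(FPP.weightLaw G ν), ∃ A : Set V, A.Finite ∧
        ∀ a b : ℕ → ℤ, Tendsto a atTop atBot → Tendsto b atTop atTop →
          ∀ n : ℕ, a n ≤ 0 → 0 ≤ b n →
            (∃ p : G.Walk (γ (a n)) (γ (b n)), FPP.IsWGeodesic ω p) ∧
            ∀ p : G.Walk (γ (a n)) (γ (b n)), FPP.IsWGeodesic ω p →
              ∃ v ∈ p.support, v ∈ A) := by
  obtain ⟨δ, hδ⟩ := hhyp.exists_thin hconn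
  obtain ⟨q, nb, hnb, hq⟩ := hdeg.exists_finset
  refine ⟨?_, fun γ hγ => ?_⟩
  · obtain ⟨γ, hγ⟩ := hgeo
    filter_upwards [FPP.ae_exists_forall_dist_le hconn hdeg hδ ν hmean hzero
      hγ.isQuasiGeodesic] with ω ⟨m, hm⟩
    exact hγ.exists_isBiWGeodesic hconn hdeg hm
  · obtain ⟨C, K, hγ'⟩ := hγ.exists_isQuasiGeodesic
    filter_upwards [FPP.ae_exists_forall_dist_le hconn hdeg hδ ν hmean hzero hγ'] with ω ⟨m, hm⟩
    obtain ⟨B, hB, -⟩ := FPP.exists_finset_ball hconn hnb hq (γ 0) m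
    refine ⟨B, B.finite_toSet, fun a b _ _ n ha hb => ⟨(hm _ _ ha hb).1, fun p hp => ?_⟩⟩
    obtain ⟨v, hv, hd⟩ := (hm _ _ ha hb).2 p hp
    exact ⟨v, hv, hB v hd⟩
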